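/- All Hilbert spaces are finite-dimensional complex Hilbert spaces. A quantum channel is a linear, completely positive, trace-preserving map $\mathcal N\colon\mathcal B(\mathcal H_A)\to\mathcal B(\mathcal H_B)$. An isometric extension of $\mathcal N$ is an isometry $V\colon\mathcal H_A\to\mathcal H_B\otimes\mathcal H_E$ with $\mathcal N(\rho)=\operatorname{tr}_E(V\rho V^\dagger)$, and the complementary channel with respect to $V$ is $\mathcal N^c(\rho)=\operatorname{tr}_B(V\rho V^\dagger)$, $\mathcal N^c\colon\mathcal B(\mathcal H_A)\to\mathcal B(\mathcal H_E)$. With $\|M\|_1=\operatorname{tr}\sqrt{M^\dagger M}$, the diamond norm of a linear map $\Phi\colon\mathcal B(\mathcal H)\to\mathcal B(\mathcal K)$ is $$\|\Phi\|_\diamond=\sup\{\|(\mathrm{id}_{\mathbb C^n}\otimes\Phi)(M)\|_1 : n\in\mathbb N,\ M\in\mathcal B(\mathbb C^n\otimes\mathcal H),\ \|M\|_1=1\}.$$ The channel $\mathcal N$ is called $\eta$-degradable (with respect to $\mathcal N^c$) if there is a quantum channel $\mathcal M\colon\mathcal B(\mathcal H_B)\to\mathcal B(\mathcal H_E)$ with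 $\|\mathcal N^c-\mathcal M\circ\mathcal N\|_\diamond\le\eta$; the degradability parameter $\mathrm{dg}(\mathcal N)$ is the infimum of all such $\eta$. Theorem. Let $\varepsilon\in[0,2]$ and let $\mathcal N\colon\mathcal B(\mathcal H_A)\to\mathcal B(\mathcal H_A)$ be a quantum channel with $\|\mathcal N-\mathrm{id}\|_\diamond\le\varepsilon$. Then, for every isometric extension of $\mathcal N$, the corresponding complementary channel $\mathcal N^c$ is a quantum channel and $$\|\mathcal N^c-\mathcal N^c\circ\mathcal N\|_\diamond\le 2\varepsilon^{3/2}.$$ Consequently $\mathcal N$ is $2\varepsilon^{3/2}$-degradable, with $\mathcal N^c$ as an approximate degrading map, and $\mathrm{dg}(\mathcal N)\le 2\varepsilon^{3/2}$. -/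

import Mathlib

open scoped Matrix MatrixOrder ComplexOrder ENNReal

noncomputable section

/-- The trace norm `‖M‖₁ = tr √(M† M)` (the trace is a nonnegative real number). -/
def traceNorm {m : Type*} [Fintype m] [DecidableEq m] (M : Matrix m m ℂ) : ℝ :=
  (CFC.sqrt (Mᴴ * M)).trace.re

/-- The map `id_{ℂⁿ} ⊗ Φ`: a matrix on `ℂⁿ ⊗ H` is an `n × n` block matrix with entries in `B(H)`,
and `Φ` is applied to each block. -/
def ampliation {a b : Type*} (n : ℕ)
    (Φ : Matrix a a ℂ →ₗ[ℂ] Matrix b b ℂ) (M : Matrix (Fin n × a) (Fin n × a) ℂ) :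
    Matrix (Fin n × b) (Fin n × b) ℂ :=
  Matrix.of fun x y => Φ (Matrix.of fun p q => M (x.1, p) (y.1, q)) x.2 y.2

/-- The diamond norm: the supremum of `‖(id_{ℂⁿ} ⊗ Φ)(M)‖₁` over all `n` and all `M` with
`‖M‖₁ = 1`. It takes values in `[0, ∞]`, so that no boundedness is presupposed. -/
def diamondNorm {a b : Type*} [Fintype a] [DecidableEq a] [Fintype b] [DecidableEq b]
    (Φ : Matrix a a ℂ →ₗ[ℂ] Matrix b b ℂ) : ℝ≥0∞ :=
  ⨆ (n : ℕ) (M : Matrix (Fin n × a) (Fin n × a) ℂ) (_ : traceNorm M = 1),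
    ENNReal.ofReal (traceNorm (ampliation n Φ M))

/-- A quantum channel: a linear, completely positive, trace-preserving map. -/
structure IsQuantumChannel {a b : Type*} [Fintype a] [Fintype b]
    (Φ : Matrix a a ℂ →ₗ[ℂ] Matrix b b ℂ) : Prop where
  completelyPositive : ∀ (n : ℕ) (M : Matrix (Fin n × a) (Fin n × a) ℂ),
    M.PosSemidef → (ampliation n Φ M).PosSemidef
  tracePreserving : ∀ M : Matrix a a ℂ, (Φ M).trace = M.trace

/-- The partial trace `tr_E : B(H_B ⊗ H_E) → B(H_B)` over the second factor. -/
def partialTraceSnd {b e : Type*} [Fintype e] (X : Matrix (b × e) (b × e) ℂ) : Matrix b b ℂ :=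
  Matrix.of fun i j => ∑ k, X (i, k) (j, k)

/-- The partial trace `tr_B : B(H_B ⊗ H_E) → B(H_E)` over the first factor. -/
def partialTraceFst {b e : Type*} [Fintype b] (X : Matrix (b × e) (b × e) ℂ) : Matrix e e ℂ :=
  Matrix.of fun k l => ∑ i, X (i, k) (i, l)

/-- `V : H_A → H_B ⊗ H_E` is an isometric extension (Stinespring dilation) of `N`: it is an isometry
and `N ρ = tr_E (V ρ V†)`. -/
structure IsIsometricExtension {a b e : Type*} [Fintype a] [DecidableEq a] [Fintype b] [Fintype e]
    (N : Matrix a a ℂ →ₗ[ℂ] Matrix b b ℂ) (V : Matrix (b × e) a ℂ) : Prop where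
  isometry : Vᴴ * V = 1
  dilation : ∀ ρ : Matrix a a ℂ, N ρ = partialTraceSnd (V * ρ * Vᴴ)

/-- The complementary channel `ρ ↦ tr_B (V ρ V†)` with respect to an isometric extension `V`. -/
def complementaryChannel {a b e : Type*} [Fintype a] [Fintype b]
    (V : Matrix (b × e) a ℂ) : Matrix a a ℂ →ₗ[ℂ] Matrix e e ℂ where
  toFun ρ := partialTraceFst (V * ρ * Vᴴ)
  map_add' ρ σ := by
    ext k l
    simp [partialTraceFst, Matrix.mul_add, Matrix.add_mul, Finset.sum_add_distrib]
  map_smul' c ρ := by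
    ext k l
    simp [partialTraceFst, Finset.mul_sum]

/-- `N : A → B`, with complementary channel `Nc : A → E`, is `η`-degradable: there is a quantum
channel `D : B → E` with `‖Nc - D ∘ N‖_⋄ ≤ η`. -/
def IsApproxDegradable {a b e : Type*} [Fintype a] [DecidableEq a] [Fintype b]
    [Fintype e] [DecidableEq e]
    (N : Matrix a a ℂ →ₗ[ℂ] Matrix b b ℂ) (Nc : Matrix a a ℂ →ₗ[ℂ] Matrix e e ℂ)
    (η : ℝ≥0∞) : Prop :=
  ∃ D : Matrix b b ℂ →ₗ[ℂ] Matrix e e ℂ,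
    IsQuantumChannel D ∧ diamondNorm (Nc - D ∘ₗ N) ≤ η

/-- The degradability parameter `dg(N)`: the smallest `η` such that `N` is `η`-degradable. -/
def degradabilityParameter {a b e : Type*} [Fintype a] [DecidableEq a] [Fintype b]
    [Fintype e] [DecidableEq e]
    (N : Matrix a a ℂ →ₗ[ℂ] Matrix b b ℂ) (Nc : Matrix a a ℂ →ₗ[ℂ] Matrix e e ℂ) : ℝ≥0∞ :=
  sInf {η : ℝ≥0∞ | IsApproxDegradable N Nc η}

end

/-!
For a purification `φ` of a state `ρ`, pairing `(id ⊗ (N - id))(φ φ†)` with the reflection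
`1 - 2 φ φ†` shows that the entanglement fidelity `∑ₖ |tr (Kₖ ρ)|²` is at least `1 - d / 2`, where
`d = ‖N - id‖_⋄` and the `Kₖ` are the Kraus operators of `V`. As `ρ` varies, the vectors
`(tr (Kₖ ρ))ₖ` form a convex set. Let `ψ` be the point of its closure of minimal norm. Minimality
gives `‖ψ‖² ≤ Re ⟪ψ, (tr (Kₖ ρ))ₖ⟫` for all `ρ` at once, so with `W x = x ⊗ ψ`, where `ψ` is
deliberately not normalised, `‖V - W‖² ≤ 1 - ‖ψ‖² ≤ d / 2`.

The complementary channel `Wᶜ` of `W` depends only on the trace of its input, hence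
`Nᶜ - Nᶜ ∘ N = (Nᶜ - Wᶜ) ∘ (id - N)`. The first factor has diamond norm at most
`2 ‖V - W‖ ≤ √2 d^(1/2)`, the second has diamond norm `d`.
-/

section TraceNorm

open scoped Matrix.Norms.L2Operator

variable {m : Type*} [Fintype m] [DecidableEq m]

lemma ofReal_traceNorm (M : Matrix m m ℂ) : (traceNorm M : ℂ) = (CFC.abs M).trace :=
  (Complex.eq_re_of_ofReal_le
    (Matrix.nonneg_iff_posSemidef.1 (CFC.abs_nonneg M)).trace_nonneg).symm

lemma traceNorm_nonneg (M : Matrix m m ℂ) : 0 ≤ traceNorm M := by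
  rw [← Complex.zero_le_real, ofReal_traceNorm]
  exact (Matrix.nonneg_iff_posSemidef.1 (CFC.abs_nonneg M)).trace_nonneg

lemma traceNorm_of_posSemidef {M : Matrix m m ℂ} (hM : M.PosSemidef) :
    traceNorm M = M.trace.re :=
  congrArg (fun A : Matrix m m ℂ => A.trace.re) (CFC.abs_of_nonneg M hM.nonneg)

lemma traceNorm_neg (M : Matrix m m ℂ) : traceNorm (-M) = traceNorm M :=
  congrArg (fun A : Matrix m m ℂ => A.trace.re) (CFC.abs_neg M)

lemma traceNorm_smul (c : ℂ) (M : Matrix m m ℂ) : traceNorm (c • M) = ‖c‖ * traceNorm M := by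
  refine (congrArg (fun A : Matrix m m ℂ => A.trace.re) (CFC.abs_smul c M)).trans ?_
  simp only [Matrix.trace_smul, Complex.smul_re, smul_eq_mul]
  rfl

lemma norm_toEuclideanCLM_abs_apply (M : Matrix m m ℂ) (x : EuclideanSpace ℂ m) :
    ‖Matrix.toEuclideanCLM (𝕜 := ℂ) (CFC.abs M) x‖ = ‖Matrix.toEuclideanCLM (𝕜 := ℂ) M x‖ := by
  have norm_sq (A : Matrix m m ℂ) : ‖Matrix.toEuclideanCLM (𝕜 := ℂ) A x‖ ^ 2 =
      RCLike.re (inner ℂ (Matrix.toEuclideanCLM (𝕜 := ℂ) (star A * A) x) x) := by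
    rw [ContinuousLinearMap.apply_norm_sq_eq_inner_adjoint_left,
      ← ContinuousLinearMap.star_eq_adjoint, ← map_star, map_mul]
    rfl
  have habs : star (CFC.abs M) * CFC.abs M = star M * M := by
    rw [(CFC.abs_nonneg M).isSelfAdjoint.star_eq, CFC.abs_mul_abs]
  rw [← sq_eq_sq₀ (norm_nonneg _) (norm_nonneg _), norm_sq, norm_sq, habs]

lemma trace_eq_sum_inner_toEuclideanCLM {ι : Type*} [Fintype ι] (A : Matrix m m ℂ)
    (b : OrthonormalBasis ι ℂ (EuclideanSpace ℂ m)) :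
    A.trace = ∑ i, inner ℂ (b i) (Matrix.toEuclideanCLM (𝕜 := ℂ) A (b i)) := by
  have h := LinearMap.trace_eq_sum_inner (Matrix.toEuclideanCLM (𝕜 := ℂ) A).toLinearMap b
  rwa [Matrix.coe_toEuclideanCLM_eq_toEuclideanLin, Matrix.toEuclideanLin_eq_toLin_orthonormal,
    Matrix.trace_toLin_eq] at h

lemma norm_trace_mul_le (Z M : Matrix m m ℂ) : ‖(Z * M).trace‖ ≤ ‖Z‖ * traceNorm M := by
  have habs : (CFC.abs M).PosSemidef := Matrix.nonneg_iff_posSemidef.1 (CFC.abs_nonneg M)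
  have hP : (CFC.abs M).IsHermitian := habs.isHermitian
  set b := hP.eigenvectorBasis
  have hterm (i : m) : ‖inner ℂ (b i) (Matrix.toEuclideanCLM (𝕜 := ℂ) (Z * M) (b i))‖ ≤
      ‖Z‖ * hP.eigenvalues i := by
    have heigen : ‖Matrix.toEuclideanCLM (𝕜 := ℂ) M (b i)‖ = hP.eigenvalues i := by
      have hvec : Matrix.toEuclideanCLM (𝕜 := ℂ) (CFC.abs M) (b i) = hP.eigenvalues i • b i :=
        WithLp.ofLp_injective 2 (hP.mulVec_eigenvectorBasis i)
      rw [← norm_toEuclideanCLM_abs_apply, hvec, norm_smul, b.norm_eq_one, mul_one,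
        Real.norm_of_nonneg (habs.eigenvalues_nonneg i)]
    calc ‖inner ℂ (b i) (Matrix.toEuclideanCLM (𝕜 := ℂ) (Z * M) (b i))‖
        ≤ ‖b i‖ * ‖Matrix.toEuclideanCLM (𝕜 := ℂ) (Z * M) (b i)‖ := norm_inner_le_norm _ _
      _ = ‖Matrix.toEuclideanCLM (𝕜 := ℂ) Z (Matrix.toEuclideanCLM (𝕜 := ℂ) M (b i))‖ := by
        rw [b.norm_eq_one, one_mul, map_mul]
        rfl
      _ ≤ ‖Z‖ * ‖Matrix.toEuclideanCLM (𝕜 := ℂ) M (b i)‖ := ContinuousLinearMap.le_opNorm _ _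
      _ = ‖Z‖ * hP.eigenvalues i := by rw [heigen]
  have htrace : traceNorm M = ∑ i, hP.eigenvalues i := by
    rw [← Complex.ofReal_inj, ofReal_traceNorm, hP.trace_eq_sum_eigenvalues, Complex.ofReal_sum]
    rfl
  calc ‖(Z * M).trace‖
      ≤ ∑ i, ‖Z‖ * hP.eigenvalues i := by
        rw [trace_eq_sum_inner_toEuclideanCLM _ b]
        exact norm_sum_le_of_le _ fun i _ => hterm i
    _ = ‖Z‖ * traceNorm M := by
        rw [← Finset.mul_sum, ← htrace]

lemma exists_norm_le_one_mul_eq_abs (M : Matrix m m ℂ) :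
    ∃ U : Matrix m m ℂ, ‖U‖ ≤ 1 ∧ U * M = CFC.abs M := by
  set P := CFC.abs M
  have hP : IsSelfAdjoint P := (CFC.abs_nonneg M).isSelfAdjoint
  have hcont (f : ℝ → ℝ) : ContinuousOn f (spectrum ℝ P) :=
    (Matrix.finite_real_spectrum (A := P)).continuousOn f
  -- the pseudoinverse of `|M|`, by the convention `0⁻¹ = 0`
  set R := cfc (fun x : ℝ => x⁻¹) P
  have hR : star R = R := cfc_predicate (fun x : ℝ => x⁻¹) P
  have hRP : R * P = cfc (fun x : ℝ => x⁻¹ * x) P := by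
    rw [cfc_mul _ _ _ (hcont _) (hcont _), cfc_id' ℝ P]
  refine ⟨R * star M, ?_, ?_⟩
  · have hsq : R * star M * star (R * star M) = R * P * star (R * P) := by
      simp only [star_mul, star_star, hR, hP.star_eq, mul_assoc]
      rw [← mul_assoc (star M), ← CFC.abs_mul_abs, mul_assoc]
    have hnorm : ‖R * star M‖ = ‖R * P‖ :=
      mul_self_inj_of_nonneg (norm_nonneg _) (norm_nonneg _) |>.1 <| by
        rw [← CStarRing.norm_self_mul_star, hsq, CStarRing.norm_self_mul_star]
    rw [hnorm, hRP]
    refine norm_cfc_le zero_le_one fun x _ => ?_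
    rcases eq_or_ne x 0 with rfl | hx <;> simp [*]
  · rw [mul_assoc, ← CFC.abs_mul_abs, ← mul_assoc, hRP]
    calc cfc (fun x : ℝ => x⁻¹ * x) P * P = cfc (fun x : ℝ => x⁻¹ * x * x) P := by
          rw [cfc_mul (fun x : ℝ => x⁻¹ * x) (fun x => x) P (hcont _) (hcont _), cfc_id' ℝ P]
      _ = P := by simp only [inv_mul_mul_self, cfc_id' ℝ P]

lemma exists_trace_mul_eq_traceNorm (M : Matrix m m ℂ) :
    ∃ U : Matrix m m ℂ, ‖U‖ ≤ 1 ∧ (U * M).trace = traceNorm M := by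
  obtain ⟨U, hU, hUM⟩ := exists_norm_le_one_mul_eq_abs M
  exact ⟨U, hU, by rw [hUM, ofReal_traceNorm]⟩

lemma traceNorm_le_of_forall_norm_trace_mul_le {M : Matrix m m ℂ} {c : ℝ}
    (h : ∀ U : Matrix m m ℂ, ‖U‖ ≤ 1 → ‖(U * M).trace‖ ≤ c) : traceNorm M ≤ c := by
  obtain ⟨U, hU, hUM⟩ := exists_trace_mul_eq_traceNorm M
  simpa only [hUM, Complex.norm_of_nonneg (traceNorm_nonneg M)] using h U hU

lemma eq_zero_of_traceNorm_eq_zero {M : Matrix m m ℂ} (h : traceNorm M = 0) : M = 0 := by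
  have hle := norm_trace_mul_le Mᴴ M
  rw [h, mul_zero] at hle
  exact Matrix.trace_conjTranspose_mul_self_eq_zero_iff.1 (norm_le_zero_iff.1 hle)

lemma traceNorm_add_le (M N : Matrix m m ℂ) : traceNorm (M + N) ≤ traceNorm M + traceNorm N := by
  refine traceNorm_le_of_forall_norm_trace_mul_le fun U hU => ?_
  have hcontraction (X : Matrix m m ℂ) : ‖(U * X).trace‖ ≤ traceNorm X :=
    (norm_trace_mul_le U X).trans (mul_le_of_le_one_left (traceNorm_nonneg X) hU)
  rw [mul_add, Matrix.trace_add]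
  exact norm_add_le_of_le (hcontraction M) (hcontraction N)

lemma traceNorm_mul_mul_le {n : Type*} [Fintype n] [DecidableEq n] (A : Matrix m n ℂ)
    (M : Matrix n n ℂ) (B : Matrix n m ℂ) :
    traceNorm (A * M * B) ≤ ‖A‖ * traceNorm M * ‖B‖ := by
  refine traceNorm_le_of_forall_norm_trace_mul_le fun U hU => ?_
  have hcycle : (U * (A * M * B)).trace = (B * U * A * M).trace := by
    rw [← Matrix.mul_assoc, Matrix.trace_mul_comm]
    simp only [Matrix.mul_assoc]
  calc ‖(U * (A * M * B)).trace‖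
      ≤ ‖B * U * A‖ * traceNorm M := hcycle ▸ norm_trace_mul_le _ _
    _ ≤ ‖B‖ * 1 * ‖A‖ * traceNorm M := by
      gcongr
      · exact traceNorm_nonneg M
      · refine (Matrix.l2_opNorm_mul _ _).trans (mul_le_mul_of_nonneg_right ?_ (norm_nonneg _))
        exact (Matrix.l2_opNorm_mul _ _).trans (by gcongr)
    _ = ‖A‖ * traceNorm M * ‖B‖ := by ring

end TraceNorm

section OperatorNorm

open scoped Matrix.Norms.L2Operator Kronecker

variable {m n : Type*} [Fintype m] [Fintype n] [DecidableEq n]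

lemma l2_opNorm_one_kronecker_le {p : Type*} [Fintype p] [DecidableEq p] (T : Matrix m n ℂ) :
    ‖(1 : Matrix p p ℂ) ⊗ₖ T‖ ≤ ‖T‖ := by
  have hT : Tᴴ * T ≤ algebraMap ℝ (Matrix n n ℂ) ‖Tᴴ * T‖ :=
    IsSelfAdjoint.le_algebraMap_norm_self (Matrix.isHermitian_conjTranspose_mul_self T)
  set S := (1 : Matrix p p ℂ) ⊗ₖ T
  have hS : Sᴴ * S = 1 ⊗ₖ (Tᴴ * T) := by
    rw [Matrix.conjTranspose_kronecker, ← Matrix.mul_kronecker_mul, Matrix.conjTranspose_one,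
      Matrix.one_mul]
  have hle : Sᴴ * S ≤ algebraMap ℝ (Matrix (p × n) (p × n) ℂ) ‖Tᴴ * T‖ := by
    rw [hS, Matrix.le_iff]
    convert (Matrix.PosSemidef.one (n := p) (R := ℂ)).kronecker (Matrix.le_iff.1 hT) using 1
    ext x y
    simp only [Matrix.sub_apply, Matrix.algebraMap_matrix_apply, Matrix.kroneckerMap_apply,
      Matrix.one_apply, Prod.ext_iff, mul_sub, ite_and, ite_mul, one_mul, zero_mul]
  have hnorm := (CStarAlgebra.norm_le_iff_le_algebraMap _ (norm_nonneg _)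
    (Matrix.posSemidef_conjTranspose_mul_self S).nonneg).2 hle
  rw [Matrix.l2_opNorm_conjTranspose_mul_self, Matrix.l2_opNorm_conjTranspose_mul_self] at hnorm
  exact (mul_self_le_mul_self_iff (norm_nonneg _) (norm_nonneg _)).2 hnorm

lemma l2_opNorm_le_one_of_isometry {T : Matrix m n ℂ} (hT : Tᴴ * T = 1) : ‖T‖ ≤ 1 := by
  have hone : ‖(1 : Matrix n n ℂ)‖ ≤ 1 := by
    rw [← Matrix.diagonal_one, Matrix.l2_opNorm_diagonal]
    exact (pi_norm_le_iff_of_nonneg zero_le_one).2 fun _ => norm_one.le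
  rw [← hT, Matrix.l2_opNorm_conjTranspose_mul_self] at hone
  nlinarith [norm_nonneg T]

lemma l2_opNorm_sq_le_of_forall_trace_le [Nonempty n] {T : Matrix m n ℂ} {c : ℝ}
    (h : ∀ ρ : Matrix n n ℂ, ρ.PosSemidef → ρ.trace = 1 → (Tᴴ * T * ρ).trace.re ≤ c) :
    ‖T‖ ^ 2 ≤ c := by
  have hunit (x : EuclideanSpace ℂ n) (hx : ‖x‖ = 1) : ‖Matrix.toEuclideanLin T x‖ ^ 2 ≤ c := by
    -- test `h` on the density matrix `x x†`
    have htr : (Matrix.vecMulVec x (star x)).trace = 1 := by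
      rw [Matrix.trace_vecMulVec, ← EuclideanSpace.inner_eq_star_dotProduct,
        inner_self_eq_norm_sq_to_K, hx]
      simp
    convert h _ (Matrix.posSemidef_vecMulVec_self_star _) htr using 1
    rw [← inner_self_eq_norm_sq (𝕜 := ℂ), EuclideanSpace.inner_eq_star_dotProduct, Matrix.mul_assoc,
      Matrix.mul_vecMulVec, Matrix.mul_vecMulVec, Matrix.trace_vecMulVec]
    rw [dotProduct_comm (_ *ᵥ _), Matrix.dotProduct_mulVec, ← Matrix.star_mulVec,
      dotProduct_comm]
    rfl
  have hc : 0 ≤ c := by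
    obtain ⟨x, hx⟩ := exists_norm_eq (EuclideanSpace ℂ n) zero_le_one
    exact (sq_nonneg _).trans (hunit x hx)
  have hnorm : ‖T‖ ≤ √c := by
    rw [Matrix.l2_opNorm_def]
    exact ContinuousLinearMap.opNorm_le_of_unit_norm (Real.sqrt_nonneg c) fun x hx =>
      Real.le_sqrt_of_sq_le (hunit x hx)
  exact (Real.le_sqrt (norm_nonneg _) hc).1 hnorm

end OperatorNorm

section ComplementaryChannel

open scoped Matrix.Norms.L2Operator Kronecker

section PartialTrace

variable {b e : Type*} [Fintype b]

lemma trace_partialTraceFst [Fintype e] (X : Matrix (b × e) (b × e) ℂ) :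
    (partialTraceFst X).trace = X.trace :=
  (Fintype.sum_prod_type_right fun x => X x x).symm

lemma trace_partialTraceSnd [Fintype e] (X : Matrix (b × e) (b × e) ℂ) :
    (partialTraceSnd X).trace = X.trace :=
  (Fintype.sum_prod_type fun x => X x x).symm

lemma trace_mul_partialTraceFst [DecidableEq b] [Fintype e] (U : Matrix e e ℂ)
    (X : Matrix (b × e) (b × e) ℂ) :
    (U * partialTraceFst X).trace = (((1 : Matrix b b ℂ) ⊗ₖ U) * X).trace := by
  simp only [Matrix.trace, Matrix.diag, Matrix.mul_apply, partialTraceFst, Matrix.of_apply,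
    Matrix.kroneckerMap_apply, Matrix.one_apply, Fintype.sum_prod_type, Finset.mul_sum, ite_mul,
    one_mul, zero_mul, Finset.sum_ite_irrel, Finset.sum_const_zero, Finset.sum_ite_eq,
    Finset.mem_univ, if_true]
  exact (Finset.sum_congr rfl fun _ _ => Finset.sum_comm).trans Finset.sum_comm

lemma posSemidef_partialTraceFst {X : Matrix (b × e) (b × e) ℂ} (hX : X.PosSemidef) :
    (partialTraceFst X).PosSemidef := by
  have hsum : partialTraceFst X = ∑ i, X.submatrix (fun k => (i, k)) (fun k => (i, k)) := by
    ext k l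
    simp only [partialTraceFst, Matrix.of_apply, Matrix.sum_apply, Matrix.submatrix_apply]
  rw [hsum]
  exact Matrix.posSemidef_sum _ fun i _ => hX.submatrix _

lemma partialTraceFst_sub (X Y : Matrix (b × e) (b × e) ℂ) :
    partialTraceFst (X - Y) = partialTraceFst X - partialTraceFst Y := by
  ext k l
  simp only [partialTraceFst, Matrix.of_apply, Matrix.sub_apply, Finset.sum_sub_distrib]

lemma traceNorm_partialTraceFst_le [DecidableEq b] [Fintype e] [DecidableEq e]
    (X : Matrix (b × e) (b × e) ℂ) : traceNorm (partialTraceFst X) ≤ traceNorm X := by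
  refine traceNorm_le_of_forall_norm_trace_mul_le fun U hU => ?_
  rw [trace_mul_partialTraceFst]
  exact (norm_trace_mul_le _ X).trans <| mul_le_of_le_one_left (traceNorm_nonneg X)
    ((l2_opNorm_one_kronecker_le U).trans hU)

end PartialTrace

variable {a b e : Type*}

/-- The operator `1 ⊗ T : ℂⁿ ⊗ H_A → ℂⁿ ⊗ (H_B ⊗ H_E)`, with the tensor factors of its codomain
reordered to `H_B ⊗ (ℂⁿ ⊗ H_E)`, so that `ℂⁿ` counts as a part of the environment. -/
def idTensor (n : ℕ) (T : Matrix (b × e) a ℂ) : Matrix (b × (Fin n × e)) (Fin n × a) ℂ :=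
  ((1 : Matrix (Fin n) (Fin n) ℂ) ⊗ₖ T).submatrix (fun x => (x.2.1, (x.1, x.2.2))) id

lemma idTensor_sub (n : ℕ) (S T : Matrix (b × e) a ℂ) :
    idTensor n (S - T) = idTensor n S - idTensor n T := by
  ext x y
  simp only [idTensor, Matrix.submatrix_apply, Matrix.sub_apply, Matrix.kroneckerMap_apply, mul_sub]

lemma conjTranspose_idTensor_mul_idTensor [Fintype b] [Fintype e] (n : ℕ) (T : Matrix (b × e) a ℂ) :
    (idTensor n T)ᴴ * idTensor n T =
      ((1 : Matrix (Fin n) (Fin n) ℂ) ⊗ₖ T)ᴴ * ((1 : Matrix (Fin n) (Fin n) ℂ) ⊗ₖ T) := by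
  let reorder : b × (Fin n × e) ≃ Fin n × (b × e) :=
    ⟨fun x => (x.2.1, (x.1, x.2.2)), fun x => (x.2.1, (x.1, x.2.2)), fun _ => rfl, fun _ => rfl⟩
  exact Matrix.submatrix_mul_equiv ((1 : Matrix (Fin n) (Fin n) ℂ) ⊗ₖ T)ᴴ
    ((1 : Matrix (Fin n) (Fin n) ℂ) ⊗ₖ T) id reorder id

variable [Fintype a] [Fintype b]

lemma l2_opNorm_idTensor_le [DecidableEq a] [Fintype e] (n : ℕ) (T : Matrix (b × e) a ℂ) :
    ‖idTensor n T‖ ≤ ‖T‖ := by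
  have hnorm : ‖idTensor n T‖ = ‖(1 : Matrix (Fin n) (Fin n) ℂ) ⊗ₖ T‖ :=
    mul_self_inj_of_nonneg (norm_nonneg _) (norm_nonneg _) |>.1 <| by
      rw [← Matrix.l2_opNorm_conjTranspose_mul_self, conjTranspose_idTensor_mul_idTensor,
        Matrix.l2_opNorm_conjTranspose_mul_self]
  exact hnorm.trans_le (l2_opNorm_one_kronecker_le T)

lemma ampliation_complementaryChannel (n : ℕ) (T : Matrix (b × e) a ℂ)
    (M : Matrix (Fin n × a) (Fin n × a) ℂ) :
    ampliation n (complementaryChannel T) M = complementaryChannel (idTensor n T) M := by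
  ext x y
  simp only [ampliation, complementaryChannel, partialTraceFst, idTensor, LinearMap.coe_mk,
    AddHom.coe_mk, Matrix.of_apply, Matrix.mul_apply, Matrix.conjTranspose_apply,
    Matrix.submatrix_apply, id, Matrix.kroneckerMap_apply, Matrix.one_apply, Fintype.sum_prod_type,
    ite_mul, one_mul, zero_mul, Finset.sum_ite_irrel, Finset.sum_const_zero, Finset.sum_ite_eq,
    Finset.mem_univ, if_true, apply_ite star, star_zero, mul_ite, mul_zero]

lemma trace_complementaryChannel [DecidableEq a] [Fintype e] {V : Matrix (b × e) a ℂ}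
    (hV : Vᴴ * V = 1) (ρ : Matrix a a ℂ) : (complementaryChannel V ρ).trace = ρ.trace := by
  calc (complementaryChannel V ρ).trace
      = (V * ρ * Vᴴ).trace := trace_partialTraceFst _
    _ = ρ.trace := by
      rw [Matrix.trace_mul_comm, ← Matrix.mul_assoc, hV, Matrix.one_mul]

lemma isQuantumChannel_complementaryChannel [DecidableEq a] [Fintype e] {V : Matrix (b × e) a ℂ}
    (hV : Vᴴ * V = 1) : IsQuantumChannel (complementaryChannel V) where
  completelyPositive n M hM := by
    rw [ampliation_complementaryChannel]
    exact posSemidef_partialTraceFst (hM.mul_mul_conjTranspose_same _)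
  tracePreserving := trace_complementaryChannel hV

lemma traceNorm_complementaryChannel_sub_le [DecidableEq a] [Fintype e] [DecidableEq e]
    (S T : Matrix (b × e) a ℂ) (M : Matrix a a ℂ) :
    traceNorm (complementaryChannel S M - complementaryChannel T M) ≤
      (‖S‖ + ‖T‖) * ‖S - T‖ * traceNorm M := by
  classical
  have hsplit : S * M * Sᴴ - T * M * Tᴴ = S * M * (S - T)ᴴ + (S - T) * M * Tᴴ := by
    rw [Matrix.conjTranspose_sub, Matrix.mul_sub, Matrix.sub_mul, Matrix.sub_mul]
    abel
  calc traceNorm (complementaryChannel S M - complementaryChannel T M)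
      = traceNorm (partialTraceFst (S * M * Sᴴ - T * M * Tᴴ)) := by
        rw [partialTraceFst_sub]
        rfl
    _ ≤ traceNorm (S * M * (S - T)ᴴ + (S - T) * M * Tᴴ) :=
        hsplit ▸ traceNorm_partialTraceFst_le _
    _ ≤ ‖S‖ * traceNorm M * ‖(S - T)ᴴ‖ + ‖S - T‖ * traceNorm M * ‖Tᴴ‖ :=
        (traceNorm_add_le _ _).trans <|
          add_le_add (traceNorm_mul_mul_le _ _ _) (traceNorm_mul_mul_le _ _ _)
    _ = (‖S‖ + ‖T‖) * ‖S - T‖ * traceNorm M := by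
        rw [Matrix.l2_opNorm_conjTranspose, Matrix.l2_opNorm_conjTranspose]
        ring

end ComplementaryChannel

section DiamondNorm

variable {a b c : Type*}

lemma ampliation_smul (n : ℕ) (Φ : Matrix a a ℂ →ₗ[ℂ] Matrix b b ℂ) (z : ℂ)
    (M : Matrix (Fin n × a) (Fin n × a) ℂ) :
    ampliation n Φ (z • M) = z • ampliation n Φ M := by
  ext x y
  exact congrFun₂ (map_smul Φ z (Matrix.of fun p q => M (x.1, p) (y.1, q))) x.2 y.2

lemma trace_ampliation [Fintype a] [Fintype b] {Φ : Matrix a a ℂ →ₗ[ℂ] Matrix b b ℂ}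
    (hΦ : ∀ ρ, (Φ ρ).trace = ρ.trace) (n : ℕ) (M : Matrix (Fin n × a) (Fin n × a) ℂ) :
    (ampliation n Φ M).trace = M.trace := by
  calc (ampliation n Φ M).trace
      = ∑ i, (Φ (Matrix.of fun p q => M (i, p) (i, q))).trace := Fintype.sum_prod_type _
    _ = ∑ i, (Matrix.of fun p q => M (i, p) (i, q)).trace :=
      Finset.sum_congr rfl fun _ _ => hΦ _
    _ = M.trace := (Fintype.sum_prod_type fun x => M x x).symm

variable [Fintype a] [DecidableEq a] [Fintype b] [Fintype c] [DecidableEq c]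

open scoped Matrix.Norms.L2Operator in
lemma diamondNorm_complementaryChannel_sub_le (S T : Matrix (b × c) a ℂ) :
    diamondNorm (complementaryChannel S - complementaryChannel T) ≤
      ENNReal.ofReal ((‖S‖ + ‖T‖) * ‖S - T‖) := by
  refine iSup_le fun n => iSup₂_le fun M hM => ENNReal.ofReal_le_ofReal ?_
  calc traceNorm (ampliation n (complementaryChannel S - complementaryChannel T) M)
      = traceNorm (complementaryChannel (idTensor n S) M -
          complementaryChannel (idTensor n T) M) := by
        rw [← ampliation_complementaryChannel, ← ampliation_complementaryChannel]
        rfl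
    _ ≤ (‖idTensor n S‖ + ‖idTensor n T‖) * ‖idTensor n S - idTensor n T‖ * 1 :=
        hM ▸ traceNorm_complementaryChannel_sub_le _ _ M
    _ ≤ (‖S‖ + ‖T‖) * ‖S - T‖ := by
        rw [mul_one, ← idTensor_sub]
        gcongr <;> exact l2_opNorm_idTensor_le n _

variable [DecidableEq b]

lemma ofReal_traceNorm_ampliation_le (n : ℕ) (Φ : Matrix a a ℂ →ₗ[ℂ] Matrix b b ℂ)
    (M : Matrix (Fin n × a) (Fin n × a) ℂ) :
    ENNReal.ofReal (traceNorm (ampliation n Φ M)) ≤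
      diamondNorm Φ * ENNReal.ofReal (traceNorm M) := by
  rcases eq_or_ne (traceNorm M) 0 with hM | hM
  · have hzero : ampliation n Φ M = (0 : ℂ) • ampliation n Φ M := by
      rw [← ampliation_smul, eq_zero_of_traceNorm_eq_zero hM, smul_zero]
    rw [hzero, traceNorm_smul, norm_zero, zero_mul, ENNReal.ofReal_zero]
    exact zero_le
  · set Y := ((traceNorm M)⁻¹ : ℂ) • M
    have hY : traceNorm Y = 1 := by
      rw [traceNorm_smul, norm_inv, Complex.norm_of_nonneg (traceNorm_nonneg M),
        inv_mul_cancel₀ hM]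
    have hMY : M = (traceNorm M : ℂ) • Y := (smul_inv_smul₀ (Complex.ofReal_ne_zero.2 hM) M).symm
    have hle : ENNReal.ofReal (traceNorm (ampliation n Φ Y)) ≤ diamondNorm Φ :=
      le_iSup_of_le n (le_iSup₂_of_le Y hY le_rfl)
    calc ENNReal.ofReal (traceNorm (ampliation n Φ M))
        = ENNReal.ofReal (traceNorm M) * ENNReal.ofReal (traceNorm (ampliation n Φ Y)) := by
          conv_lhs => rw [hMY, ampliation_smul, traceNorm_smul,
            Complex.norm_of_nonneg (traceNorm_nonneg M), ENNReal.ofReal_mul (traceNorm_nonneg M)]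
      _ ≤ diamondNorm Φ * ENNReal.ofReal (traceNorm M) := by
          rw [mul_comm]
          gcongr

lemma diamondNorm_comp_le (Ψ : Matrix b b ℂ →ₗ[ℂ] Matrix c c ℂ)
    (Φ : Matrix a a ℂ →ₗ[ℂ] Matrix b b ℂ) :
    diamondNorm (Ψ ∘ₗ Φ) ≤ diamondNorm Ψ * diamondNorm Φ := by
  refine iSup_le fun n => iSup₂_le fun M hM => ?_
  calc ENNReal.ofReal (traceNorm (ampliation n Ψ (ampliation n Φ M)))
      ≤ diamondNorm Ψ * ENNReal.ofReal (traceNorm (ampliation n Φ M)) :=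
        ofReal_traceNorm_ampliation_le n Ψ _
    _ ≤ diamondNorm Ψ * (diamondNorm Φ * ENNReal.ofReal (traceNorm M)) := by
        gcongr
        exact ofReal_traceNorm_ampliation_le n Φ M
    _ = diamondNorm Ψ * diamondNorm Φ := by rw [hM, ENNReal.ofReal_one, mul_one]

lemma diamondNorm_sub_comm (Φ Ψ : Matrix a a ℂ →ₗ[ℂ] Matrix b b ℂ) :
    diamondNorm (Φ - Ψ) = diamondNorm (Ψ - Φ) := by
  have hneg (n : ℕ) (M : Matrix (Fin n × a) (Fin n × a) ℂ) :
      ampliation n (Φ - Ψ) M = -ampliation n (Ψ - Φ) M := by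
    ext x y
    exact (neg_sub _ _).symm
  simp only [diamondNorm, hneg, traceNorm_neg]

end DiamondNorm

section InformationDisturbance

open scoped Matrix.Norms.L2Operator

lemma exists_mem_closure_forall_norm_sq_le_inner {F : Type*} [NormedAddCommGroup F]
    [InnerProductSpace ℝ F] [CompleteSpace F] {K : Set F} (hK : Convex ℝ K) (hne : K.Nonempty) :
    ∃ v ∈ closure K, ∀ w ∈ K, ‖v‖ ^ 2 ≤ inner ℝ v w := by
  obtain ⟨v, hv, hmin⟩ := exists_norm_eq_iInf_of_complete_convex hne.closure
    isClosed_closure.isComplete hK.closure 0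
  refine ⟨v, hv, fun w hw => ?_⟩
  have hle := (norm_eq_iInf_iff_real_inner_le_zero hK.closure hv).1 hmin w (subset_closure hw)
  rw [zero_sub, inner_neg_left, inner_sub_right, real_inner_self_eq_norm_sq] at hle
  linarith

variable {a b e : Type*}

/-- The Kraus operator `(1 ⊗ ⟨k|) V` of the channel `ρ ↦ tr_E (V ρ V†)`. -/
def krausOperator (V : Matrix (b × e) a ℂ) (k : e) : Matrix b a ℂ :=
  V.submatrix (fun i => (i, k)) id

/-- The operator `x ↦ x ⊗ ψ`, adjoining the environment in the state `ψ`, which need not be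
normalised. -/
def tensorVector (a : Type*) [DecidableEq a] (ψ : EuclideanSpace ℂ e) : Matrix (a × e) a ℂ :=
  Matrix.of fun x j => (1 : Matrix a a ℂ) x.1 j * ψ x.2

lemma krausOperator_tensorVector [DecidableEq a] (ψ : EuclideanSpace ℂ e) (k : e) :
    krausOperator (tensorVector a ψ) k = ψ k • 1 := by
  ext i j
  exact mul_comm _ _

lemma exists_eq_mul_conjTranspose [Finite a] {ρ : Matrix a a ℂ} (hρ : ρ.PosSemidef) :
    ∃ (n : ℕ) (D : Matrix a (Fin n) ℂ), ρ = D * Dᴴ := by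
  classical
  cases nonempty_fintype a
  obtain ⟨B, hB⟩ := CStarAlgebra.nonneg_iff_eq_mul_star_self.1 hρ.nonneg
  refine ⟨Fintype.card a, B.submatrix id (Fintype.equivFin a).symm, ?_⟩
  rw [Matrix.conjTranspose_submatrix, Matrix.submatrix_mul_equiv, hB]
  rfl

variable [Fintype a]

/-- The density matrices, i.e. the states of the quantum system with state space `ℂᵃ`. -/
def densityMatrices (a : Type*) [Fintype a] : Set (Matrix a a ℂ) :=
  {ρ | ρ.PosSemidef ∧ ρ.trace = 1}

lemma convex_densityMatrices : Convex ℝ (densityMatrices a) := by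
  rintro ρ ⟨hρ, hρtr⟩ σ ⟨hσ, hσtr⟩ s t hs ht hst
  refine ⟨(hρ.smul hs).add (hσ.smul ht), ?_⟩
  rw [Matrix.trace_add, Matrix.trace_smul, Matrix.trace_smul, hρtr, hσtr, ← add_smul, hst, one_smul]

lemma densityMatrices_nonempty [Nonempty a] : (densityMatrices a).Nonempty := by
  classical
  inhabit a
  exact ⟨Matrix.diagonal (Pi.single default 1),
    Matrix.PosSemidef.diagonal (Pi.single_nonneg.2 zero_le_one),
    by rw [Matrix.trace_diagonal, Finset.sum_pi_single']; simp⟩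

section Fidelity

variable [DecidableEq a]

lemma l2_opNorm_reflection_le_one {φ : a → ℂ} (hφ : star φ ⬝ᵥ φ = 1) :
    ‖1 - (2 : ℂ) • Matrix.vecMulVec φ (star φ)‖ ≤ 1 := by
  set P := Matrix.vecMulVec φ (star φ)
  have hP : Pᴴ = P := by rw [Matrix.conjTranspose_vecMulVec, star_star]
  have hPP : P * P = P := by
    rw [Matrix.vecMulVec_mul_vecMulVec, hφ, one_smul]
  refine l2_opNorm_le_one_of_isometry ?_
  rw [Matrix.conjTranspose_sub, Matrix.conjTranspose_smul, hP, Matrix.conjTranspose_one]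
  simp only [Matrix.mul_sub, Matrix.sub_mul, Matrix.mul_one, Matrix.one_mul, Matrix.smul_mul,
    Matrix.mul_smul, hPP, Complex.star_def, Complex.conj_ofNat]
  module

lemma ofReal_two_mul_one_sub_fidelity_le {N : Matrix a a ℂ →ₗ[ℂ] Matrix a a ℂ}
    (hN : ∀ ρ, (N ρ).trace = ρ.trace) {n : ℕ} {φ : Fin n × a → ℂ} (hφ : star φ ⬝ᵥ φ = 1) :
    ENNReal.ofReal
        (2 * (1 - (star φ ⬝ᵥ ampliation n N (Matrix.vecMulVec φ (star φ)) *ᵥ φ).re)) ≤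
      diamondNorm (N - LinearMap.id) := by
  set P := Matrix.vecMulVec φ (star φ)
  set F := star φ ⬝ᵥ ampliation n N P *ᵥ φ
  set R := 1 - (2 : ℂ) • P
  have htrP : P.trace = 1 := by rw [Matrix.trace_vecMulVec, dotProduct_comm, hφ]
  have hPnorm : traceNorm P = 1 := by
    rw [traceNorm_of_posSemidef (Matrix.posSemidef_vecMulVec_self_star φ), htrP, Complex.one_re]
  have hquad (X : Matrix (Fin n × a) (Fin n × a) ℂ) : (P * X).trace = star φ ⬝ᵥ X *ᵥ φ := by
    rw [Matrix.trace_mul_comm, Matrix.mul_vecMulVec, Matrix.trace_vecMulVec, dotProduct_comm]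
  have hpair : (R * ampliation n (N - LinearMap.id) P).trace = 2 * (1 - F) := by
    have hPP : star φ ⬝ᵥ P *ᵥ φ = 1 := by
      rw [← hquad, Matrix.vecMulVec_mul_vecMulVec, hφ, one_smul, htrP]
    have hsub : ampliation n (N - LinearMap.id) P = ampliation n N P - P := rfl
    rw [hsub, Matrix.sub_mul, Matrix.one_mul, Matrix.smul_mul, Matrix.trace_sub, Matrix.trace_smul,
      hquad, Matrix.sub_mulVec, dotProduct_sub, hPP, Matrix.trace_sub, trace_ampliation hN,
      smul_eq_mul]
    ring
  have hle : 2 * (1 - F.re) ≤ traceNorm (ampliation n (N - LinearMap.id) P) := by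
    calc 2 * (1 - F.re)
        = (2 * (1 - F)).re := by simp
      _ ≤ ‖(R * ampliation n (N - LinearMap.id) P).trace‖ := hpair ▸ Complex.re_le_norm _
      _ ≤ ‖R‖ * traceNorm (ampliation n (N - LinearMap.id) P) := norm_trace_mul_le _ _
      _ ≤ traceNorm (ampliation n (N - LinearMap.id) P) :=
        mul_le_of_le_one_left (traceNorm_nonneg _) (l2_opNorm_reflection_le_one hφ)
  exact le_iSup_of_le n (le_iSup₂_of_le P hPnorm (ENNReal.ofReal_le_ofReal hle))

end Fidelity

lemma complementaryChannel_apply [Fintype b] (V : Matrix (b × e) a ℂ) (ρ : Matrix a a ℂ)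
    (k l : e) :
    complementaryChannel V ρ k l = (krausOperator V k * ρ * (krausOperator V l)ᴴ).trace :=
  rfl

lemma IsIsometricExtension.trace_apply [DecidableEq a] [Fintype b] [Fintype e]
    {N : Matrix a a ℂ →ₗ[ℂ] Matrix b b ℂ} {V : Matrix (b × e) a ℂ}
    (hV : IsIsometricExtension N V) (ρ : Matrix a a ℂ) : (N ρ).trace = ρ.trace := by
  rw [hV.dilation, trace_partialTraceSnd, Matrix.trace_mul_comm, ← Matrix.mul_assoc, hV.isometry,
    Matrix.one_mul]

lemma IsIsometricExtension.ampliation_vecMulVec_vec [DecidableEq a] [Fintype b] [Fintype e]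
    {N : Matrix a a ℂ →ₗ[ℂ] Matrix b b ℂ} {V : Matrix (b × e) a ℂ}
    (hV : IsIsometricExtension N V) {n : ℕ} (D : Matrix a (Fin n) ℂ) :
    ampliation n N (Matrix.vecMulVec D.vec (star D.vec)) =
      ∑ k, Matrix.vecMulVec (krausOperator V k * D).vec (star (krausOperator V k * D).vec) := by
  ext x y
  have hblock : (Matrix.of fun p q => Matrix.vecMulVec D.vec (star D.vec) (x.1, p) (y.1, q)) =
      Matrix.vecMulVec (D.col x.1) (star (D.col y.1)) := rfl
  rw [ampliation, Matrix.of_apply, hblock, hV.dilation, Matrix.mul_vecMulVec,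
    Matrix.vecMulVec_mul, ← Matrix.star_mulVec, Matrix.sum_apply]
  rfl

/-- The vector `(tr (K_k ρ))_k` in the environment, where `K_k` are the Kraus operators of `V`. Its
squared norm is the entanglement fidelity of the channel `ρ ↦ tr_E (V ρ V†)` at `ρ`. -/
def krausTraces (V : Matrix (a × e) a ℂ) : Matrix a a ℂ →ₗ[ℂ] EuclideanSpace ℂ e :=
  (WithLp.linearEquiv 2 ℂ (e → ℂ)).symm.toLinearMap ∘ₗ
    LinearMap.pi fun k => Matrix.traceLinearMap a ℂ ℂ ∘ₗ LinearMap.mulLeft ℂ (krausOperator V k)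

lemma krausTraces_apply (V : Matrix (a × e) a ℂ) (ρ : Matrix a a ℂ) (k : e) :
    krausTraces V ρ k = (krausOperator V k * ρ).trace :=
  rfl

lemma IsIsometricExtension.ofReal_two_mul_one_sub_norm_krausTraces_sq_le [DecidableEq a]
    [Fintype e] {N : Matrix a a ℂ →ₗ[ℂ] Matrix a a ℂ} {V : Matrix (a × e) a ℂ}
    (hV : IsIsometricExtension N V) {ρ : Matrix a a ℂ} (hρ : ρ ∈ densityMatrices a) :
    ENNReal.ofReal (2 * (1 - ‖krausTraces V ρ‖ ^ 2)) ≤ diamondNorm (N - LinearMap.id) := by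
  obtain ⟨n, D, rfl⟩ := exists_eq_mul_conjTranspose hρ.1
  have hD : star D.vec ⬝ᵥ D.vec = 1 := by
    rw [Matrix.star_vec_dotProduct_vec, Matrix.trace_mul_comm, hρ.2]
  have hfid : star D.vec ⬝ᵥ ampliation n N (Matrix.vecMulVec D.vec (star D.vec)) *ᵥ D.vec =
      (‖krausTraces V (D * Dᴴ)‖ ^ 2 : ℝ) := by
    have hterm (k : e) : star D.vec ⬝ᵥ
        (Matrix.vecMulVec (krausOperator V k * D).vec (star (krausOperator V k * D).vec)) *ᵥ D.vec =
        (‖krausTraces V (D * Dᴴ) k‖ ^ 2 : ℝ) := by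
      have hoverlap : star D.vec ⬝ᵥ (krausOperator V k * D).vec = krausTraces V (D * Dᴴ) k := by
        rw [Matrix.star_vec_dotProduct_vec, krausTraces_apply, Matrix.trace_mul_comm,
          Matrix.mul_assoc]
      rw [Matrix.vecMulVec_mulVec, op_smul_eq_smul, dotProduct_smul, hoverlap,
        Matrix.star_dotProduct _ D.vec, hoverlap, smul_eq_mul, Complex.star_def, Complex.conj_mul',
        Complex.ofReal_pow]
    rw [hV.ampliation_vecMulVec_vec, Matrix.sum_mulVec, dotProduct_sum, EuclideanSpace.norm_sq_eq,
      Complex.ofReal_sum]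
    exact Finset.sum_congr rfl fun k _ => hterm k
  simpa only [hfid, Complex.ofReal_re] using ofReal_two_mul_one_sub_fidelity_le hV.trace_apply hD

section TensorVector

variable [DecidableEq a]

lemma complementaryChannel_tensorVector (ψ : EuclideanSpace ℂ e) (ρ : Matrix a a ℂ) :
    complementaryChannel (tensorVector a ψ) ρ =
      ρ.trace • Matrix.vecMulVec ψ.ofLp (star ψ.ofLp) := by
  ext k l
  rw [complementaryChannel_apply, krausOperator_tensorVector, krausOperator_tensorVector,
    Matrix.conjTranspose_smul, Matrix.conjTranspose_one, Matrix.smul_mul, Matrix.one_mul,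
    Matrix.mul_smul, Matrix.mul_one, Matrix.trace_smul, Matrix.trace_smul, Matrix.smul_apply,
    Matrix.vecMulVec_apply, Pi.star_apply]
  simp only [smul_eq_mul]
  ring

variable [Fintype e]

lemma conjTranspose_tensorVector_mul (ψ : EuclideanSpace ℂ e) (V : Matrix (a × e) a ℂ) :
    (tensorVector a ψ)ᴴ * V = ∑ k, star (ψ k) • krausOperator V k := by
  ext i j
  simp only [tensorVector, krausOperator, Matrix.mul_apply, Matrix.conjTranspose_apply,
    Matrix.of_apply, Matrix.one_apply, Matrix.sum_apply, Matrix.smul_apply, Matrix.submatrix_apply,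
    Fintype.sum_prod_type, ite_mul, one_mul, zero_mul, apply_ite star, star_zero,
    Finset.sum_ite_irrel, Finset.sum_const_zero, Finset.sum_ite_eq', Finset.mem_univ, if_true,
    smul_eq_mul, id]

lemma conjTranspose_tensorVector_mul_self (ψ : EuclideanSpace ℂ e) :
    (tensorVector a ψ)ᴴ * tensorVector a ψ = ((‖ψ‖ ^ 2 : ℝ) : ℂ) • 1 := by
  rw [conjTranspose_tensorVector_mul, EuclideanSpace.norm_sq_eq, Complex.ofReal_sum,
    Finset.sum_smul]
  refine Finset.sum_congr rfl fun k _ => ?_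
  rw [krausOperator_tensorVector, smul_smul, Complex.star_def, Complex.conj_mul',
    Complex.ofReal_pow]

lemma trace_conjTranspose_tensorVector_mul (ψ : EuclideanSpace ℂ e) (V : Matrix (a × e) a ℂ)
    (ρ : Matrix a a ℂ) :
    ((tensorVector a ψ)ᴴ * V * ρ).trace = inner ℂ ψ (krausTraces V ρ) := by
  rw [conjTranspose_tensorVector_mul, Matrix.sum_mul, Matrix.trace_sum, PiLp.inner_apply]
  refine Finset.sum_congr rfl fun k _ => ?_
  rw [Matrix.smul_mul, Matrix.trace_smul, krausTraces_apply, smul_eq_mul, RCLike.inner_apply,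
    mul_comm]
  rfl

lemma l2_opNorm_tensorVector_le_one [Nonempty a] {ψ : EuclideanSpace ℂ e} (hψ : ‖ψ‖ ≤ 1) :
    ‖tensorVector a ψ‖ ≤ 1 := by
  refine (sq_le_one_iff₀ (norm_nonneg _)).1 <|
    l2_opNorm_sq_le_of_forall_trace_le fun ρ _ htr => ?_
  rw [conjTranspose_tensorVector_mul_self, Matrix.smul_mul, Matrix.one_mul, Matrix.trace_smul, htr,
    smul_eq_mul, mul_one, Complex.ofReal_re]
  exact pow_le_one₀ (norm_nonneg _) hψ

variable {N : Matrix a a ℂ →ₗ[ℂ] Matrix a a ℂ} {V : Matrix (a × e) a ℂ}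

lemma IsIsometricExtension.l2_opNorm_sub_tensorVector_sq_le [Nonempty a]
    (hV : IsIsometricExtension N V) {ψ : EuclideanSpace ℂ e}
    (hψ : ∀ ρ ∈ densityMatrices a, ‖ψ‖ ^ 2 ≤ (inner ℂ ψ (krausTraces V ρ)).re) :
    ‖V - tensorVector a ψ‖ ^ 2 ≤ 1 - ‖ψ‖ ^ 2 := by
  refine l2_opNorm_sq_le_of_forall_trace_le fun ρ hρ htr => ?_
  set W := tensorVector a ψ
  have hcross : (Vᴴ * W * ρ).trace = star (Wᴴ * V * ρ).trace := by
    rw [← Matrix.trace_conjTranspose, Matrix.conjTranspose_mul, Matrix.conjTranspose_mul,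
      Matrix.conjTranspose_conjTranspose, hρ.isHermitian.eq, Matrix.trace_mul_comm]
  have hoverlap : (Wᴴ * V * ρ).trace = inner ℂ ψ (krausTraces V ρ) :=
    trace_conjTranspose_tensorVector_mul ψ V ρ
  have hexpand : ((V - W)ᴴ * (V - W) * ρ).trace.re =
      1 - 2 * (inner ℂ ψ (krausTraces V ρ)).re + ‖ψ‖ ^ 2 := by
    rw [Matrix.conjTranspose_sub, Matrix.sub_mul, Matrix.mul_sub, Matrix.mul_sub, hV.isometry,
      conjTranspose_tensorVector_mul_self]
    simp only [Matrix.sub_mul, Matrix.trace_sub, Matrix.one_mul, Matrix.smul_mul,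
      Matrix.trace_smul, htr, hcross, hoverlap, Complex.sub_re, Complex.one_re, smul_eq_mul,
      mul_one, Complex.ofReal_re, Complex.star_def, Complex.conj_re]
    ring
  linarith [hψ ρ ⟨hρ, htr⟩]

lemma IsIsometricExtension.exists_l2_opNorm_sub_tensorVector_sq_le
    (hV : IsIsometricExtension N V) :
    ∃ ψ : EuclideanSpace ℂ e, ‖tensorVector a ψ‖ ≤ 1 ∧
      ENNReal.ofReal (2 * ‖V - tensorVector a ψ‖ ^ 2) ≤ diamondNorm (N - LinearMap.id) := by
  rcases isEmpty_or_nonempty a with ha | ha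
  · refine ⟨0, ?_, ?_⟩ <;> simp [Subsingleton.elim _ (0 : Matrix (a × e) a ℂ)]
  obtain ⟨ψ, hψ, hmin⟩ := exists_mem_closure_forall_norm_sq_le_inner
    (convex_densityMatrices.linear_image ((krausTraces V).restrictScalars ℝ))
    (densityMatrices_nonempty.image _)
  have hclose : ENNReal.ofReal (2 * (1 - ‖ψ‖ ^ 2)) ≤ diamondNorm (N - LinearMap.id) := by
    have hclosed : IsClosed {x : EuclideanSpace ℂ e |
        ENNReal.ofReal (2 * (1 - ‖x‖ ^ 2)) ≤ diamondNorm (N - LinearMap.id)} :=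
      isClosed_le (ENNReal.continuous_ofReal.comp (by fun_prop)) continuous_const
    refine closure_minimal ?_ hclosed hψ
    rintro _ ⟨ρ, hρ, rfl⟩
    exact hV.ofReal_two_mul_one_sub_norm_krausTraces_sq_le hρ
  have hdist : ‖V - tensorVector a ψ‖ ^ 2 ≤ 1 - ‖ψ‖ ^ 2 := by
    have hre (x : EuclideanSpace ℂ e) : inner ℝ ψ x = (inner ℂ ψ x).re := by
      simp [PiLp.inner_apply]
    exact hV.l2_opNorm_sub_tensorVector_sq_le fun ρ hρ => hre _ ▸ hmin _ ⟨ρ, hρ, rfl⟩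
  have hψ_le : ‖ψ‖ ≤ 1 :=
    (sq_le_one_iff₀ (norm_nonneg _)).1 (sub_nonneg.1 ((sq_nonneg _).trans hdist))
  refine ⟨ψ, l2_opNorm_tensorVector_le_one hψ_le, (ENNReal.ofReal_le_ofReal ?_).trans hclose⟩
  gcongr

variable [DecidableEq e]

lemma IsIsometricExtension.exists_diamondNorm_complementaryChannel_sub_le
    (hV : IsIsometricExtension N V) :
    ∃ ψ : EuclideanSpace ℂ e,
      diamondNorm (complementaryChannel V - complementaryChannel (tensorVector a ψ)) ≤
        ENNReal.ofReal √2 * diamondNorm (N - LinearMap.id) ^ (1 / 2 : ℝ) := by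
  obtain ⟨ψ, hW, hdist⟩ := hV.exists_l2_opNorm_sub_tensorVector_sq_le
  set δ := ‖V - tensorVector a ψ‖
  refine ⟨ψ, (diamondNorm_complementaryChannel_sub_le V (tensorVector a ψ)).trans ?_⟩
  calc ENNReal.ofReal ((‖V‖ + ‖tensorVector a ψ‖) * δ)
      ≤ ENNReal.ofReal ((1 + 1) * δ) := by
        gcongr
        exact l2_opNorm_le_one_of_isometry hV.isometry
    _ = ENNReal.ofReal √2 * ENNReal.ofReal (2 * δ ^ 2) ^ (1 / 2 : ℝ) := by
        rw [ENNReal.ofReal_rpow_of_nonneg (by positivity) (by norm_num),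
          ← ENNReal.ofReal_mul (Real.sqrt_nonneg 2), ← Real.sqrt_eq_rpow,
          Real.sqrt_mul zero_le_two, Real.sqrt_sq (norm_nonneg _), ← mul_assoc,
          Real.mul_self_sqrt zero_le_two, one_add_one_eq_two]
    _ ≤ _ := by gcongr

lemma IsIsometricExtension.diamondNorm_complementaryChannel_sub_comp_le
    (hV : IsIsometricExtension N V) {T : Matrix a a ℂ →ₗ[ℂ] Matrix a a ℂ}
    (hT : ∀ ρ, (T ρ).trace = ρ.trace) :
    diamondNorm (complementaryChannel V - complementaryChannel V ∘ₗ T) ≤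
      ENNReal.ofReal √2 * diamondNorm (N - LinearMap.id) ^ (1 / 2 : ℝ) *
        diamondNorm (T - LinearMap.id) := by
  obtain ⟨ψ, hψ⟩ := hV.exists_diamondNorm_complementaryChannel_sub_le
  have hfactor : complementaryChannel V - complementaryChannel V ∘ₗ T =
      (complementaryChannel V - complementaryChannel (tensorVector a ψ)) ∘ₗ
        (LinearMap.id - T) := by
    ext1 ρ
    simp only [LinearMap.sub_apply, LinearMap.comp_apply, LinearMap.id_apply, map_sub,
      complementaryChannel_tensorVector, hT]
    abel
  calc diamondNorm (complementaryChannel V - complementaryChannel V ∘ₗ T)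
      ≤ diamondNorm (complementaryChannel V - complementaryChannel (tensorVector a ψ)) *
          diamondNorm (LinearMap.id - T) := hfactor ▸ diamondNorm_comp_le _ _
    _ ≤ ENNReal.ofReal √2 * diamondNorm (N - LinearMap.id) ^ (1 / 2 : ℝ) *
          diamondNorm (T - LinearMap.id) := by
        rw [diamondNorm_sub_comm LinearMap.id]
        gcongr

end TensorVector

end InformationDisturbance

lemma ofReal_sqrt_two_mul_rpow_le {d : ℝ≥0∞} {ε : ℝ} (hε : 0 ≤ ε) (hd : d ≤ ENNReal.ofReal ε) :
    ENNReal.ofReal √2 * d ^ (3 / 2 : ℝ) ≤ ENNReal.ofReal (2 * ε ^ (3 / 2 : ℝ)) := by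
  have hsqrt : √2 ≤ 2 := Real.sqrt_le_iff.2 ⟨zero_le_two, by norm_num⟩
  rw [ENNReal.ofReal_mul zero_le_two, ← ENNReal.ofReal_rpow_of_nonneg hε (by norm_num)]
  gcongr

theorem theorem3p3_general {a e : Type*} [Fintype a] [DecidableEq a] [Fintype e] [DecidableEq e]
    (N : Matrix a a ℂ →ₗ[ℂ] Matrix a a ℂ) (V : Matrix (a × e) a ℂ)
    (hV : IsIsometricExtension N V) :
    IsQuantumChannel (complementaryChannel V) ∧
      diamondNorm (complementaryChannel V - complementaryChannel V ∘ₗ N) ≤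
        ENNReal.ofReal √2 * diamondNorm (N - LinearMap.id) ^ (3 / 2 : ℝ) := by
  refine ⟨isQuantumChannel_complementaryChannel hV.isometry,
    (hV.diamondNorm_complementaryChannel_sub_comp_le hV.trace_apply).trans_eq ?_⟩
  rw [show (3 / 2 : ℝ) = 1 / 2 + 1 by norm_num,
    ENNReal.rpow_add_of_nonneg _ _ (by norm_num) zero_le_one, ENNReal.rpow_one, mul_assoc]

theorem theorem3p3 {a e : Type*} [Fintype a] [DecidableEq a] [Fintype e] [DecidableEq e]
    (N : Matrix a a ℂ →ₗ[ℂ] Matrix a a ℂ) (hN : IsQuantumChannel N)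
    (V : Matrix (a × e) a ℂ) (hV : IsIsometricExtension N V)
    (ε : ℝ) (hε : ε ∈ Set.Icc (0 : ℝ) 2)
    (hclose : diamondNorm (N - LinearMap.id) ≤ ENNReal.ofReal ε) :
    IsQuantumChannel (complementaryChannel V) ∧
      diamondNorm (complementaryChannel V - complementaryChannel V ∘ₗ N) ≤
        ENNReal.ofReal (2 * ε ^ (3 / 2 : ℝ)) ∧
      IsApproxDegradable N (complementaryChannel V) (ENNReal.ofReal (2 * ε ^ (3 / 2 : ℝ))) ∧
      degradabilityParameter N (complementaryChannel V) ≤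
        ENNReal.ofReal (2 * ε ^ (3 / 2 : ℝ)) := by
  obtain ⟨hc, hη⟩ := (theorem3p3_general N V hV).imp_right
    (·.trans (ofReal_sqrt_two_mul_rpow_le hε.1 hclose))
  exact ⟨hc, hη, ⟨_, hc, hη⟩, sInf_le ⟨_, hc, hη⟩⟩
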